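/- Let $V$ be a real vector space with $\dim V=3$, and let $\{e_1,e_2,e_3\}$ be a basis of $V$, by which $V\cong\mathbb{R}^3$ and the group $\mathrm{O}(3)$ acts on $V$. For $\alpha,\beta\in V^*$ write $\alpha\vee\beta=\frac12(\alpha\otimes\beta+\beta\otimes\alpha)$ and $\alpha\wedge\beta=\frac12(\alpha\otimes\beta-\beta\otimes\alpha)$. Let $$W=\left\{S\in \mathrm{Sym}^2(\mathrm{Sym}^2V^*)\oplus\mathrm{Sym}^2(\Lambda^2V^*)\;:\;\tau S=S\right\}\subset (V^*)^{\otimes 4},\qquad (\tau S)(v_1,v_2,v_3,v_4)=S(v_1,v_4,v_3,v_2),$$ let $\mathcal{C}_W=\{S\in W: S\ge 0\}$ be the cone of those elements of $W$ that are positive semi-definite as symmetric bilinear forms on $V\otimes V$ (via $S(v_1\otimes v_2,v_3\otimes v_4)=S(v_1,v_2,v_3,v_4)$), let $W^*$ be the dual space of $W$, and let $\mathcal{C}_W^*=\{M\in W^*: M(S)\ge 0 \text{ for all } S\in\mathcal{C}_W\}$ be the dual cone. An element $M\in W^*$ satisfies the *elastic bounds* if $M(\alpha^{\otimes 4})\ge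 0$ for all $\alpha\in V^*\setminus\{0\}$ and $M\big((\alpha\vee\beta)^{\otimes 2}+(\alpha\wedge\beta)^{\otimes 2}\big)\ge 0$ for all linearly independent $\alpha,\beta\in V^*$. The group $\mathrm{O}(3)$ acts on $W^*$ by $(A\cdot M)(S)=M(A^*S)$, where $(A^*S)(v_1,\dots,v_4)=S(Av_1,\dots,Av_4)$. Let $\mathrm{SO}(2)\subset \mathrm{O}(3)$ be the subgroup of rotations about the axis $e_3$, let $\mathbb{Z}_2^{\,3}\subset \mathrm{O}(3)$ be the subgroup generated by the reflections $Q_1,Q_2,Q_3$, where $Q_ie_i=-e_i$ and $Q_ie_j=e_j$ for $j\ne i$, and write $(W^*)^G$ for the space of $G$-invariant elements of $W^*$. **Theorem.** $(W^*)^{\mathrm{SO}(2)}\subset (W^*)^{\mathbb{Z}_2^{\,3}}$. Moreover, for every $M\in (W^*)^{\mathrm{SO}(2)}$, one has $M\in\mathcal{C}_W^*$ if and only if $M$ satisfies the elastic bounds. -/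

import Mathlib

open scoped TensorProduct

noncomputable section

namespace Amplitude

section Tensors

variable (V : Type*) [AddCommGroup V] [Module ℝ V]

/-- Covariant four-tensors on `V`, viewed as bilinear forms on `V ⊗ V`:
`S(v₁, v₂, v₃, v₄) = S (v₁ ⊗ v₂) (v₃ ⊗ v₄)`. -/
abbrev FourTensor : Type _ := LinearMap.BilinForm ℝ (V ⊗[ℝ] V)

/-- `Sym² (Sym² V*)`. -/
def symSym : Submodule ℝ (FourTensor V) where
  carrier := {S | (∀ s t, S s t = S t s) ∧ ∀ x y t, S (y ⊗ₜ x) t = S (x ⊗ₜ y) t}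
  add_mem' := by
    rintro S T ⟨h1, h2⟩ ⟨h3, h4⟩
    refine ⟨fun s t => ?_, fun x y t => ?_⟩
    · rw [LinearMap.add_apply, LinearMap.add_apply, LinearMap.add_apply, LinearMap.add_apply,
        h1 s t, h3 s t]
    · simp only [LinearMap.add_apply, h2, h4]
  zero_mem' := by simp
  smul_mem' := by
    rintro c S ⟨h1, h2⟩
    refine ⟨fun s t => ?_, fun x y t => ?_⟩
    · rw [LinearMap.smul_apply, LinearMap.smul_apply, LinearMap.smul_apply,
        LinearMap.smul_apply, h1 s t]
    · simp only [LinearMap.smul_apply, h2]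

/-- `Sym² (Λ² V*)`. -/
def symAlt : Submodule ℝ (FourTensor V) where
  carrier := {S | (∀ s t, S s t = S t s) ∧ ∀ x y t, S (y ⊗ₜ x) t = -S (x ⊗ₜ y) t}
  add_mem' := by
    rintro S T ⟨h1, h2⟩ ⟨h3, h4⟩
    refine ⟨fun s t => ?_, fun x y t => ?_⟩
    · rw [LinearMap.add_apply, LinearMap.add_apply, LinearMap.add_apply, LinearMap.add_apply,
        h1 s t, h3 s t]
    · rw [LinearMap.add_apply, LinearMap.add_apply, LinearMap.add_apply, LinearMap.add_apply,
        h2, h4, neg_add]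
  zero_mem' := by simp
  smul_mem' := by
    rintro c S ⟨h1, h2⟩
    refine ⟨fun s t => ?_, fun x y t => ?_⟩
    · rw [LinearMap.smul_apply, LinearMap.smul_apply, LinearMap.smul_apply,
        LinearMap.smul_apply, h1 s t]
    · rw [LinearMap.smul_apply, LinearMap.smul_apply, LinearMap.smul_apply,
        LinearMap.smul_apply, h2, smul_neg]

/-- The tensors with `τ S = S`, where `(τ S)(v₁, v₂, v₃, v₄) = S(v₁, v₄, v₃, v₂)`. -/
def tauInvariant : Submodule ℝ (FourTensor V) where
  carrier := {S | ∀ v₁ v₂ v₃ v₄ : V,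
    S (v₁ ⊗ₜ v₄) (v₃ ⊗ₜ v₂) = S (v₁ ⊗ₜ v₂) (v₃ ⊗ₜ v₄)}
  add_mem' := by
    intro S T h1 h2 v₁ v₂ v₃ v₄
    simp only [LinearMap.add_apply, h1 v₁ v₂ v₃ v₄, h2 v₁ v₂ v₃ v₄]
  zero_mem' := by simp
  smul_mem' := by
    intro c S h v₁ v₂ v₃ v₄
    simp only [LinearMap.smul_apply, h v₁ v₂ v₃ v₄]

/-- `W = {S ∈ Sym² (Sym² V*) ⊕ Sym² (Λ² V*) : τ S = S}`. -/
def W : Submodule ℝ (FourTensor V) := (symSym V ⊔ symAlt V) ⊓ tauInvariant V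

/-- The cone `C_W` of the elements of `W` that are positive semi-definite on `V ⊗ V`. -/
def positivityCone : Set (W V) := {S | LinearMap.BilinForm.IsPosSemidef (S : FourTensor V)}

/-- The dual cone `C_W* = {M ∈ W* : M(S) ≥ 0 for all S ∈ C_W}`. -/
def dualPositivityCone : PointedCone ℝ (Module.Dual ℝ (W V)) :=
  PointedCone.dual (Module.Dual.eval ℝ (W V)) (positivityCone V)

variable {V}

/-- `α ⊗ β ∈ V* ⊗ V*` as a linear form on `V ⊗ V`. -/
def tmulForm (α β : Module.Dual ℝ V) : Module.Dual ℝ (V ⊗[ℝ] V) :=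
  TensorProduct.dualDistrib ℝ V V (α ⊗ₜ β)

/-- `α ∨ β = (α ⊗ β + β ⊗ α) / 2`. -/
def vee (α β : Module.Dual ℝ V) : Module.Dual ℝ (V ⊗[ℝ] V) :=
  (1 / 2 : ℝ) • (tmulForm α β + tmulForm β α)

/-- `α ∧ β = (α ⊗ β - β ⊗ α) / 2`. -/
def wedge (α β : Module.Dual ℝ V) : Module.Dual ℝ (V ⊗[ℝ] V) :=
  (1 / 2 : ℝ) • (tmulForm α β - tmulForm β α)

/-- The square `γ ⊗ γ` of `γ ∈ V* ⊗ V*`, that is `(s, t) ↦ γ(s) γ(t)`. -/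
def sq (γ : Module.Dual ℝ (V ⊗[ℝ] V)) : FourTensor V := LinearMap.BilinForm.linMulLin γ γ

@[simp]
theorem tmulForm_tmul (α β : Module.Dual ℝ V) (x y : V) :
    tmulForm α β (x ⊗ₜ y) = α x * β y := rfl

@[simp]
theorem vee_tmul (α β : Module.Dual ℝ V) (x y : V) :
    vee α β (x ⊗ₜ y) = (1 / 2 : ℝ) * (α x * β y + β x * α y) := rfl

@[simp]
theorem wedge_tmul (α β : Module.Dual ℝ V) (x y : V) :
    wedge α β (x ⊗ₜ y) = (1 / 2 : ℝ) * (α x * β y - β x * α y) := rfl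

@[simp]
theorem sq_apply (γ : Module.Dual ℝ (V ⊗[ℝ] V)) (s t : V ⊗[ℝ] V) :
    sq γ s t = γ s * γ t := rfl

theorem sq_mem_symSym {γ : Module.Dual ℝ (V ⊗[ℝ] V)}
    (h : ∀ x y, γ (y ⊗ₜ x) = γ (x ⊗ₜ y)) : sq γ ∈ symSym V :=
  ⟨fun s t => by simp only [sq_apply, mul_comm], fun x y t => by simp only [sq_apply, h x y]⟩

theorem sq_mem_symAlt {γ : Module.Dual ℝ (V ⊗[ℝ] V)}
    (h : ∀ x y, γ (y ⊗ₜ x) = -γ (x ⊗ₜ y)) : sq γ ∈ symAlt V :=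
  ⟨fun s t => by simp only [sq_apply, mul_comm],
    fun x y t => by simp only [sq_apply, h x y, neg_mul]⟩

/-- The tensor `α⁴ = α ⊗ α ⊗ α ⊗ α`, as an element of `W`. -/
def fourthPower (α : Module.Dual ℝ V) : W V :=
  ⟨sq (tmulForm α α), by
    refine Submodule.mem_inf.2 ⟨Submodule.mem_sup_left (sq_mem_symSym fun x y => ?_), ?_⟩
    · simp only [tmulForm_tmul, mul_comm]
    · intro v₁ v₂ v₃ v₄
      simp only [sq_apply, tmulForm_tmul]
      ring⟩

/-- The tensor `(α ∨ β)^{⊗ 2} + (α ∧ β)^{⊗ 2}`, as an element of `W`. -/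
def elasticTensor (α β : Module.Dual ℝ V) : W V :=
  ⟨sq (vee α β) + sq (wedge α β), by
    refine Submodule.mem_inf.2 ⟨Submodule.add_mem_sup (sq_mem_symSym fun x y => ?_)
      (sq_mem_symAlt fun x y => ?_), ?_⟩
    · simp only [vee_tmul]
      ring
    · simp only [wedge_tmul]
      ring
    · intro v₁ v₂ v₃ v₄
      simp only [LinearMap.add_apply, sq_apply, vee_tmul, wedge_tmul]
      ring⟩

/-- The elastic bounds: `M(α⁴) ≥ 0` for all `α ≠ 0`, and
`M((α ∨ β)^{⊗ 2} + (α ∧ β)^{⊗ 2}) ≥ 0` for all linearly independent `α, β`. -/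
def SatisfiesElasticBounds (M : Module.Dual ℝ (W V)) : Prop :=
  (∀ α : Module.Dual ℝ V, α ≠ 0 → 0 ≤ M (fourthPower α)) ∧
    ∀ α β : Module.Dual ℝ V, LinearIndependent ℝ ![α, β] → 0 ≤ M (elasticTensor α β)

/-- The pullback `(f* S)(v₁, v₂, v₃, v₄) = S(f v₁, f v₂, f v₃, f v₄)`. -/
def pullback (f : V →ₗ[ℝ] V) : FourTensor V →ₗ[ℝ] FourTensor V where
  toFun S := S.compl₁₂ (TensorProduct.map f f) (TensorProduct.map f f)
  map_add' _ _ := rfl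
  map_smul' _ _ := rfl

@[simp]
theorem pullback_apply (f : V →ₗ[ℝ] V) (S : FourTensor V) (s t : V ⊗[ℝ] V) :
    pullback f S s t = S (TensorProduct.map f f s) (TensorProduct.map f f t) := rfl

theorem pullback_mem_W (f : V →ₗ[ℝ] V) : ∀ S ∈ W V, pullback f S ∈ W V := by
  rintro S ⟨h, hτ⟩
  obtain ⟨A, ⟨hA1, hA2⟩, B, ⟨hB1, hB2⟩, rfl⟩ := Submodule.mem_sup.1 h
  refine Submodule.mem_inf.2 ⟨?_, ?_⟩
  · rw [map_add]
    refine Submodule.add_mem_sup ⟨fun s t => ?_, fun x y t => ?_⟩ ⟨fun s t => ?_, fun x y t => ?_⟩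
    · exact hA1 _ _
    · exact hA2 _ _ _
    · exact hB1 _ _
    · exact hB2 _ _ _
  · intro v₁ v₂ v₃ v₄
    exact hτ _ _ _ _

/-- The pullback by `f`, on `W`. -/
def pullbackW (f : V →ₗ[ℝ] V) : W V →ₗ[ℝ] W V := (pullback f).restrict (pullback_mem_W f)

/-- The action on `W*` induced by the action on `V`: `(f · M)(S) = M(f* S)`. -/
def act (f : V →ₗ[ℝ] V) (M : Module.Dual ℝ (W V)) : Module.Dual ℝ (W V) := M ∘ₗ pullbackW f

end Tensors

section Groups

/-- The subgroup `SO(2) ⊂ O(3)` of the rotations about the third axis. -/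
def SO2 : Subgroup (Matrix.orthogonalGroup (Fin 3) ℝ) where
  carrier := {A | ∃ θ : ℝ, (A : Matrix (Fin 3) (Fin 3) ℝ) =
    !![Real.cos θ, -Real.sin θ, 0; Real.sin θ, Real.cos θ, 0; 0, 0, 1]}
  mul_mem' := by
    rintro A B ⟨θ, hA⟩ ⟨η, hB⟩
    refine ⟨θ + η, ?_⟩
    rw [Submonoid.coe_mul, hA, hB, Real.cos_add, Real.sin_add]
    ext i j
    fin_cases i <;> fin_cases j <;> simp [Matrix.mul_apply, Fin.sum_univ_three] <;> ring
  one_mem' := by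
    refine ⟨0, ?_⟩
    ext i j
    fin_cases i <;> fin_cases j <;> simp
  inv_mem' := by
    rintro A ⟨θ, hA⟩
    refine ⟨-θ, ?_⟩
    have h : ((A⁻¹ : Matrix.orthogonalGroup (Fin 3) ℝ) : Matrix (Fin 3) (Fin 3) ℝ)
        = star (A : Matrix (Fin 3) (Fin 3) ℝ) := rfl
    rw [h, hA]
    ext i j
    fin_cases i <;> fin_cases j <;> simp [Matrix.star_apply]

/-- The reflection `Q i`: the diagonal matrix with `i`-th entry `-1` and the other entries `1`. -/
def Q (i : Fin 3) : Matrix.orthogonalGroup (Fin 3) ℝ :=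
  ⟨Matrix.diagonal fun j => if j = i then -1 else 1, by
    rw [Matrix.mem_orthogonalGroup_iff, Matrix.diagonal_transpose, Matrix.diagonal_mul_diagonal, ← Matrix.diagonal_one]
    congr 1
    ext j
    by_cases h : j = i <;> simp [h]⟩

/-- The subgroup `ℤ₂³ ⊂ O(3)` generated by the three reflections. -/
def Z2cubed : Subgroup (Matrix.orthogonalGroup (Fin 3) ℝ) := Subgroup.closure (Set.range Q)

variable {V : Type*} [AddCommGroup V] [Module ℝ V]

/-- `(W*)^G`, for a group `G` of orthogonal matrices that acts on `V` through the basis `e`. -/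
def invariants (e : Module.Basis (Fin 3) ℝ V)
    (G : Subgroup (Matrix.orthogonalGroup (Fin 3) ℝ)) :
    Submodule ℝ (Module.Dual ℝ (W V)) where
  carrier := {M | ∀ A ∈ G, act (Matrix.toLin e e (A : Matrix (Fin 3) (Fin 3) ℝ)) M = M}
  add_mem' := by
    intro M N hM hN A hA
    have h1 := hM A hA
    have h2 := hN A hA
    simp only [act] at h1 h2 ⊢
    rw [LinearMap.add_comp, h1, h2]
  zero_mem' := by
    intro A _
    simp only [act, LinearMap.zero_comp]
  smul_mem' := by
    intro c M hM A hA
    have h1 := hM A hA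
    simp only [act] at h1 ⊢
    rw [LinearMap.smul_comp, h1]

end Groups

end Amplitude

end

/-! The index symmetries leave 21 coefficients to an element of `W*`, and invariance under rotations
leaves five. With `s` the entries of `S`, one gets `M S = A x + c₁ w + 2 c₃ v + C z + 4 d y`, where
`x = s0000 + 2 s0011 + s1111`, `w = 2 s0101 - 2 s0011`, `v = s0202 + s1212`, `z = s2222`, `y = s0022
+ s1122` (`apply_eq_of_mem_invariants`). Every index occurs evenly in each entry here, so the
reflections fix `M` too.

The elastic bounds are necessary because they test `M` on sums of squares. Conversely, they give
`c₁, c₃ ≥ 0` and `A p⁴ + (2 c₃ ± 4 d) p² q² + C q⁴ ≥ 0`, while `S ≥ 0` gives `w, x, z ≥ 0`, `y² ≤ x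
z` and `|y| ≤ v`. Write `2 c₃ v + 4 d y = 2 c₃ (v - |y|) + (2 c₃ ± 4 d) |y|`, with the sign of `y`;
`add_add_nonneg_of_quartic` then bounds the terms in `x`, `|y|`, `z`. -/

namespace Amplitude

/-! ### Index symmetries of `W` and the projection onto it -/

section SymTensor

variable {V : Type*} [AddCommGroup V] [Module ℝ V]

theorem fourTensor_ext {S T : FourTensor V}
    (h : ∀ x y z t : V, S (x ⊗ₜ y) (z ⊗ₜ t) = T (x ⊗ₜ y) (z ⊗ₜ t)) : S = T := by
  refine TensorProduct.ext' fun x y => TensorProduct.ext' fun z t => h x y z t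

theorem fourTensor_ext_basis {ι : Type*} (e : Module.Basis ι ℝ V) {S T : FourTensor V}
    (h : ∀ i j k l, S (e i ⊗ₜ e j) (e k ⊗ₜ e l) = T (e i ⊗ₜ e j) (e k ⊗ₜ e l)) : S = T := by
  refine (e.tensorProduct e).ext fun p => (e.tensorProduct e).ext fun q => ?_
  simpa only [Module.Basis.tensorProduct_apply'] using h p.1 p.2 q.1 q.2

theorem W_symm {S : FourTensor V} (hS : S ∈ W V) (s t : V ⊗[ℝ] V) : S s t = S t s := by
  obtain ⟨A, hA, B, hB, rfl⟩ := Submodule.mem_sup.1 (Submodule.mem_inf.1 hS).1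
  simp only [LinearMap.add_apply, hA.1 s t, hB.1 s t]

theorem W_swap {S : FourTensor V} (hS : S ∈ W V) (x y z t : V) :
    S (x ⊗ₜ y) (z ⊗ₜ t) = S (y ⊗ₜ x) (t ⊗ₜ z) := by
  obtain ⟨A, hA, B, hB, rfl⟩ := Submodule.mem_sup.1 (Submodule.mem_inf.1 hS).1
  simp only [LinearMap.add_apply]
  rw [hA.2 x y, hA.1 _ (t ⊗ₜ z), hA.2 z t, hA.1 (z ⊗ₜ t), hB.2 x y, hB.1 _ (t ⊗ₜ z), hB.2 z t,
    hB.1 (z ⊗ₜ t), neg_neg]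

theorem W_tau {S : FourTensor V} (hS : S ∈ W V) (x y z t : V) :
    S (x ⊗ₜ y) (z ⊗ₜ t) = S (x ⊗ₜ t) (z ⊗ₜ y) :=
  ((Submodule.mem_inf.1 hS).2 x y z t).symm

theorem W_tau' {S : FourTensor V} (hS : S ∈ W V) (x y z t : V) :
    S (x ⊗ₜ y) (z ⊗ₜ t) = S (z ⊗ₜ y) (x ⊗ₜ t) := by
  rw [W_symm hS, W_tau hS]

/-- The three index symmetries characterise `W`. -/
theorem mem_W_of_symm {S : FourTensor V}
    (h1 : ∀ x y z t : V, S (x ⊗ₜ y) (z ⊗ₜ t) = S (z ⊗ₜ t) (x ⊗ₜ y))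
    (h2 : ∀ x y z t : V, S (x ⊗ₜ y) (z ⊗ₜ t) = S (y ⊗ₜ x) (t ⊗ₜ z))
    (h3 : ∀ x y z t : V, S (x ⊗ₜ y) (z ⊗ₜ t) = S (x ⊗ₜ t) (z ⊗ₜ y)) : S ∈ W V := by
  have symm_of (T : FourTensor V)
      (h : ∀ x y z t : V, T (x ⊗ₜ y) (z ⊗ₜ t) = T (z ⊗ₜ t) (x ⊗ₜ y)) (s t) : T s t = T t s := by
    have : T = T.flip := fourTensor_ext fun x y z t => by simpa using h x y z t
    exact congrArg (fun U : FourTensor V => U s t) this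
  let S' : FourTensor V := S ∘ₗ (TensorProduct.comm ℝ V V).toLinearMap
  have hS' (x y : V) (t) : S' (x ⊗ₜ y) t = S (y ⊗ₜ x) t := rfl
  -- The two halves are symmetric and alternating in the first pair of slots; `h1` and `h2` make
  -- each a symmetric bilinear form.
  have key : S = (1 / 2 : ℝ) • (S + S') + (1 / 2 : ℝ) • (S - S') := by module
  refine Submodule.mem_inf.2 ⟨?_, fun x y z t => (h3 x y z t).symm⟩
  rw [key]
  refine Submodule.add_mem_sup ⟨symm_of _ fun x y z t => ?_, fun x y t => ?_⟩
    ⟨symm_of _ fun x y z t => ?_, fun x y t => ?_⟩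
  · simp only [LinearMap.smul_apply, LinearMap.add_apply, hS']
    rw [h1 x y z t, h1 y x z t, h2 z t y x]
  · simp only [LinearMap.smul_apply, LinearMap.add_apply, hS', add_comm]
  · simp only [LinearMap.smul_apply, LinearMap.sub_apply, hS']
    rw [h1 x y z t, h1 y x z t, h2 z t y x]
  · simp only [LinearMap.smul_apply, LinearMap.sub_apply, hS', smul_eq_mul]
    ring

/-- The tensor `α ⊗ β ⊗ γ ⊗ δ`. -/
noncomputable def pureTensor (α β γ δ : Module.Dual ℝ V) : FourTensor V :=
  LinearMap.BilinForm.linMulLin (tmulForm α β) (tmulForm γ δ)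

@[simp]
theorem pureTensor_tmul (α β γ δ : Module.Dual ℝ V) (x y z t : V) :
    pureTensor α β γ δ (x ⊗ₜ y) (z ⊗ₜ t) = α x * β y * (γ z * δ t) := rfl

/-- The projection of `α ⊗ β ⊗ γ ⊗ δ` to `W`. -/
noncomputable def symTensor (α β γ δ : Module.Dual ℝ V) : W V :=
  ⟨(1 / 8 : ℝ) • (pureTensor α β γ δ + pureTensor γ β α δ + pureTensor α δ γ β
    + pureTensor γ δ α β + pureTensor β α δ γ + pureTensor β γ δ α + pureTensor δ α β γ
    + pureTensor δ γ β α), by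
    refine mem_W_of_symm ?_ ?_ ?_ <;> intro x y z t <;>
      simp only [LinearMap.smul_apply, LinearMap.add_apply, pureTensor_tmul, smul_eq_mul] <;>
      ring⟩

theorem symTensor_tmul (α β γ δ : Module.Dual ℝ V) (x y z t : V) :
    (symTensor α β γ δ : FourTensor V) (x ⊗ₜ y) (z ⊗ₜ t) =
      (1 / 8 : ℝ) * (α x * β y * (γ z * δ t) + γ x * β y * (α z * δ t)
        + α x * δ y * (γ z * β t) + γ x * δ y * (α z * β t) + β x * α y * (δ z * γ t)
        + β x * γ y * (δ z * α t) + δ x * α y * (β z * γ t) + δ x * γ y * (β z * α t)) := rfl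

theorem symTensor_swap₁₃ (α β γ δ : Module.Dual ℝ V) :
    symTensor α β γ δ = symTensor γ β α δ :=
  Subtype.ext <| fourTensor_ext fun x y z t => by simp only [symTensor_tmul]; ring

theorem symTensor_swap₂₄ (α β γ δ : Module.Dual ℝ V) :
    symTensor α β γ δ = symTensor α δ γ β :=
  Subtype.ext <| fourTensor_ext fun x y z t => by simp only [symTensor_tmul]; ring

theorem symTensor_swap₁₂₃₄ (α β γ δ : Module.Dual ℝ V) :
    symTensor α β γ δ = symTensor β α δ γ :=
  Subtype.ext <| fourTensor_ext fun x y z t => by simp only [symTensor_tmul]; ring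

/-- `symTensor` as a linear function of its first argument. -/
noncomputable def symTensorFirst (β γ δ : Module.Dual ℝ V) : Module.Dual ℝ V →ₗ[ℝ] W V where
  toFun α := symTensor α β γ δ
  map_add' α α' := Subtype.ext <| fourTensor_ext fun x y z t => by
    simp only [Submodule.coe_add, LinearMap.add_apply, symTensor_tmul]; ring
  map_smul' c α := Subtype.ext <| fourTensor_ext fun x y z t => by
    simp only [Submodule.coe_smul, LinearMap.smul_apply, symTensor_tmul, RingHom.id_apply,
      smul_eq_mul]
    ring

theorem symTensor_sum {ι : Type*} (s : Finset ι) (r : ι → ℝ) (α : ι → Module.Dual ℝ V)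
    (β γ δ : Module.Dual ℝ V) :
    symTensor (∑ i ∈ s, r i • α i) β γ δ = ∑ i ∈ s, r i • symTensor (α i) β γ δ := by
  change symTensorFirst β γ δ _ = ∑ i ∈ s, r i • symTensorFirst β γ δ (α i)
  simp only [map_sum, map_smul]

theorem pullbackW_symTensor (f : V →ₗ[ℝ] V) (α β γ δ : Module.Dual ℝ V) :
    pullbackW f (symTensor α β γ δ) = symTensor (α ∘ₗ f) (β ∘ₗ f) (γ ∘ₗ f) (δ ∘ₗ f) :=
  Subtype.ext <| fourTensor_ext fun _ _ _ _ => rfl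

/-- The coefficient at a basis quadruple is the average of `S` over eight index permutations, all of
which preserve the entries of an element of `W`. -/
theorem eq_sum_symTensor {ι : Type*} [Fintype ι] [DecidableEq ι] (e : Module.Basis ι ℝ V)
    (S : W V) :
    S = ∑ i, ∑ j, ∑ k, ∑ l, ((S : FourTensor V) (e i ⊗ₜ e j) (e k ⊗ₜ e l)) •
      symTensor (e.coord i) (e.coord j) (e.coord k) (e.coord l) := by
  obtain ⟨S, hS⟩ := S
  refine Subtype.ext <| fourTensor_ext_basis e fun a b c d => ?_
  simp only [Submodule.coe_sum, LinearMap.sum_apply, Submodule.coe_smul, LinearMap.smul_apply,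
    symTensor_tmul, smul_eq_mul, Module.Basis.coord_apply, Module.Basis.repr_self,
    Finsupp.single_apply, mul_add, Finset.sum_add_distrib]
  simp only [mul_ite, mul_one, mul_zero, Finset.sum_ite_eq,
    Finset.mem_univ, if_true, Finset.sum_ite_irrel, Finset.sum_const_zero]
  have h1 (i j k l) := W_tau' hS (e i) (e j) (e k) (e l)
  have h2 (i j k l) := W_tau hS (e i) (e j) (e k) (e l)
  have h3 (i j k l) := W_swap hS (e i) (e j) (e k) (e l)
  rw [h3 b a d c, h3 b c d a, h3 d a b c, h3 d c b a, h2 c d a b, h1 c b a d, h2 a d c b]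
  ring

end SymTensor

/-! ### Coefficients of functionals and their change under a matrix -/

section Coefficients

variable {V : Type*} [AddCommGroup V] [Module ℝ V] (e : Module.Basis (Fin 3) ℝ V)
  (M : Module.Dual ℝ (W V))

/-- The coefficients of a functional on `W` with respect to a basis of `V`. -/
noncomputable def coeff (i j k l : Fin 3) : ℝ :=
  M (symTensor (e.coord i) (e.coord j) (e.coord k) (e.coord l))

theorem apply_eq_sum_coeff (S : W V) :
    M S = ∑ i, ∑ j, ∑ k, ∑ l,
      (S : FourTensor V) (e i ⊗ₜ e j) (e k ⊗ₜ e l) * coeff e M i j k l := by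
  conv_lhs => rw [eq_sum_symTensor e S]
  simp only [map_sum, map_smul, smul_eq_mul, coeff]

theorem coeff_swap₁₃ (i j k l : Fin 3) : coeff e M i j k l = coeff e M k j i l := by
  rw [coeff, symTensor_swap₁₃, coeff]

theorem coeff_swap₂₄ (i j k l : Fin 3) : coeff e M i j k l = coeff e M i l k j := by
  rw [coeff, symTensor_swap₂₄, coeff]

theorem coeff_swap₁₂₃₄ (i j k l : Fin 3) : coeff e M i j k l = coeff e M j i l k := by
  rw [coeff, symTensor_swap₁₂₃₄, coeff]

theorem coord_comp_toLin (A : Matrix (Fin 3) (Fin 3) ℝ) (i : Fin 3) :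
    e.coord i ∘ₗ Matrix.toLin e e A = ∑ j, A i j • e.coord j := by
  refine e.ext fun k => ?_
  simp [Matrix.toLin_self, Finsupp.single_apply]

theorem coeff_eq_of_act_eq {A : Matrix (Fin 3) (Fin 3) ℝ}
    (h : act (Matrix.toLin e e A) M = M) (i j k l : Fin 3) :
    coeff e M i j k l =
      ∑ a, A i a * ∑ b, A j b * ∑ c, A k c * ∑ d, A l d * coeff e M a b c d := by
  conv_lhs => rw [coeff, ← h, act, LinearMap.comp_apply, pullbackW_symTensor,
    coord_comp_toLin, coord_comp_toLin, coord_comp_toLin, coord_comp_toLin, symTensor_sum,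
    map_sum]
  refine Finset.sum_congr rfl fun a _ => ?_
  -- Only linearity in the first slot is at hand, so the swaps bring each further slot to the front
  -- and then back.
  rw [map_smul, smul_eq_mul, symTensor_swap₁₂₃₄, symTensor_sum, map_sum]
  congr 1
  refine Finset.sum_congr rfl fun b _ => ?_
  rw [map_smul, smul_eq_mul, symTensor_swap₁₂₃₄, symTensor_swap₁₃, symTensor_sum, map_sum]
  congr 1
  refine Finset.sum_congr rfl fun c _ => ?_
  rw [map_smul, smul_eq_mul, symTensor_swap₁₃, symTensor_swap₂₄, symTensor_swap₁₂₃₄,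
    symTensor_sum, map_sum]
  congr 1
  refine Finset.sum_congr rfl fun d _ => ?_
  rw [map_smul, smul_eq_mul, symTensor_swap₁₂₃₄, symTensor_swap₂₄, coeff]

end Coefficients

/-! ### Contraction of symmetric arrays -/

section Arrays

/-- The index symmetries of the coefficient arrays of elements of `W` and of `W*`. -/
structure IsSymmArray (m : Fin 3 → Fin 3 → Fin 3 → Fin 3 → ℝ) : Prop where
  swap₁₃ : ∀ i j k l, m i j k l = m k j i l
  swap₂₄ : ∀ i j k l, m i j k l = m i l k j
  swap₁₂₃₄ : ∀ i j k l, m i j k l = m j i l k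

/-- The arrays of transversely isotropic functionals, up to `IsSymmArray`. -/
structure IsTransverselyIsotropic (m : Fin 3 → Fin 3 → Fin 3 → Fin 3 → ℝ) : Prop
    extends IsSymmArray m where
  z0001 : m 0 0 0 1 = 0
  z0002 : m 0 0 0 2 = 0
  z0102 : m 0 1 0 2 = 0
  z0012 : m 0 0 1 2 = 0
  z0111 : m 0 1 1 1 = 0
  z0112 : m 0 1 1 2 = 0
  z0212 : m 0 2 1 2 = 0
  z0121 : m 0 1 2 1 = 0
  z0122 : m 0 1 2 2 = 0
  z0222 : m 0 2 2 2 = 0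
  z1112 : m 1 1 1 2 = 0
  z1222 : m 1 2 2 2 = 0
  e0011 : m 0 0 1 1 = (m 0 0 0 0 - m 0 1 0 1) / 2
  e1111 : m 1 1 1 1 = m 0 0 0 0
  e1212 : m 1 2 1 2 = m 0 2 0 2
  e1122 : m 1 1 2 2 = m 0 0 2 2

theorem IsTransverselyIsotropic.sum_mul {m s : Fin 3 → Fin 3 → Fin 3 → Fin 3 → ℝ}
    (hm : IsTransverselyIsotropic m) (hs : IsSymmArray s) :
    ∑ i, ∑ j, ∑ k, ∑ l, s i j k l * m i j k l =
      m 0 0 0 0 * (s 0 0 0 0 + 2 * s 0 0 1 1 + s 1 1 1 1)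
      + m 0 1 0 1 * (2 * s 0 1 0 1 - 2 * s 0 0 1 1)
      + 2 * m 0 2 0 2 * (s 0 2 0 2 + s 1 2 1 2)
      + m 2 2 2 2 * s 2 2 2 2 + 4 * m 0 0 2 2 * (s 0 0 2 2 + s 1 1 2 2) := by
  obtain ⟨m13, m24, m1234⟩ := hm.toIsSymmArray
  obtain ⟨s13, s24, s1234⟩ := hs
  simp only [Fin.sum_univ_three]
  -- All 81 entries are rewritten to one representative for each of the 21 orbits of indices.
  simp only [m13 1 _ 0, m13 2 _ 0, m13 2 _ 1, m24 _ 1 _ 0, m24 _ 2 _ 0, m24 _ 2 _ 1,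
    m1234 0 0 1 0, m1234 0 0 2 0, m1234 0 0 2 1, m1234 1 0 1 0, m1234 1 0 1 1, m1234 1 0 1 2,
    m1234 1 0 2 0, m1234 1 0 2 1, m1234 1 0 2 2, m1234 1 1 2 1, m1234 2 0 2 0, m1234 2 0 2 1,
    m1234 2 0 2 2, m1234 2 1 2 1, m1234 2 1 2 2]
  simp only [s13 1 _ 0, s13 2 _ 0, s13 2 _ 1, s24 _ 1 _ 0, s24 _ 2 _ 0, s24 _ 2 _ 1,
    s1234 0 0 1 0, s1234 0 0 2 0, s1234 0 0 2 1, s1234 1 0 1 0, s1234 1 0 1 1, s1234 1 0 1 2,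
    s1234 1 0 2 0, s1234 1 0 2 1, s1234 1 0 2 2, s1234 1 1 2 1, s1234 2 0 2 0, s1234 2 0 2 1,
    s1234 2 0 2 2, s1234 2 1 2 1, s1234 2 1 2 2]
  simp only [hm.z0001, hm.z0002, hm.z0102, hm.z0012, hm.z0111, hm.z0112, hm.z0212, hm.z0121, hm.z0122,
    hm.z0222, hm.z1112, hm.z1222, hm.e0011, hm.e1111, hm.e1212, hm.e1122, mul_zero]
  ring

end Arrays

/-! ### Consequences of rotation invariance -/

section Rotations

variable {V : Type*} [AddCommGroup V] [Module ℝ V] (e : Module.Basis (Fin 3) ℝ V)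
  (M : Module.Dual ℝ (W V))

theorem isSymmArray_coeff : IsSymmArray (coeff e M) :=
  ⟨coeff_swap₁₃ e M, coeff_swap₂₄ e M, coeff_swap₁₂₃₄ e M⟩

theorem isSymmArray_entries (S : W V) :
    IsSymmArray fun i j k l => (S : FourTensor V) (e i ⊗ₜ e j) (e k ⊗ₜ e l) :=
  ⟨fun _ _ _ _ => W_tau' S.2 _ _ _ _, fun _ _ _ _ => W_tau S.2 _ _ _ _,
    fun _ _ _ _ => W_swap S.2 _ _ _ _⟩

variable {e M}

theorem act_rotation_eq (hM : M ∈ invariants e SO2) (θ : ℝ) :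
    act (Matrix.toLin e e !![Real.cos θ, -Real.sin θ, 0; Real.sin θ, Real.cos θ, 0; 0, 0, 1]) M
      = M := by
  refine hM ⟨_, ?_⟩ ⟨θ, rfl⟩
  rw [Matrix.mem_orthogonalGroup_iff]
  have h := Real.sin_sq_add_cos_sq θ
  ext i j
  fin_cases i <;> fin_cases j <;>
    simp [Matrix.mul_apply, Fin.sum_univ_three] <;> linarith

theorem isTransverselyIsotropic_coeff (hM : M ∈ invariants e SO2) :
    IsTransverselyIsotropic (coeff e M) := by
  have hs := isSymmArray_coeff e M
  -- Three angles suffice. The half turn kills entries with an odd number of indices `2`, and the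
  -- quarter turn exchanges `0` and `1` up to sign. The fourth harmonic survives both, so an angle
  -- that is no multiple of `π / 2` is needed; this one has rational sine and cosine.
  have h180 (i j k l) := coeff_eq_of_act_eq e M (act_rotation_eq hM Real.pi) i j k l
  have h90 (i j k l) := coeff_eq_of_act_eq e M (act_rotation_eq hM (Real.pi / 2)) i j k l
  have h345 (i j k l) := coeff_eq_of_act_eq e M (act_rotation_eq hM (Real.arccos (3 / 5))) i j k l
  have hsin : Real.sin (Real.arccos (3 / 5)) = 4 / 5 := by
    rw [Real.sin_arccos, show (1 - (3 / 5) ^ 2 : ℝ) = (4 / 5) ^ 2 by norm_num]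
    exact Real.sqrt_sq (by norm_num)
  have hcos : Real.cos (Real.arccos (3 / 5)) = 3 / 5 :=
    Real.cos_arccos (by norm_num) (by norm_num)
  generalize coeff e M = m at *
  simp only [Fin.sum_univ_three, Real.cos_pi, Real.sin_pi, Real.cos_pi_div_two,
    Real.sin_pi_div_two, hsin, hcos] at h180 h90 h345
  obtain ⟨m13, m24, m1234⟩ := hs
  have z0002 : m 0 0 0 2 = 0 := by
    have := h180 0 0 0 2
    simp at this
    linarith
  have z0102 : m 0 1 0 2 = 0 := by
    have := h180 0 1 0 2
    simp at this
    linarith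
  have z0012 : m 0 0 1 2 = 0 := by
    have := h180 0 0 1 2
    simp at this
    linarith
  have z0112 : m 0 1 1 2 = 0 := by
    have := h180 0 1 1 2
    simp at this
    linarith
  have z0121 : m 0 1 2 1 = 0 := by
    have := h180 0 1 2 1
    simp at this
    linarith
  have z0222 : m 0 2 2 2 = 0 := by
    have := h180 0 2 2 2
    simp at this
    linarith
  have z1112 : m 1 1 1 2 = 0 := by
    have := h180 1 1 1 2
    simp at this
    linarith
  have z1222 : m 1 2 2 2 = 0 := by
    have := h180 1 2 2 2
    simp at this
    linarith
  have z0122 : m 0 1 2 2 = 0 := by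
    have := h90 0 1 2 2
    simp at this
    rw [m1234 1 0 2 2] at this
    linarith
  have z0212 : m 0 2 1 2 = 0 := by
    have := h90 0 2 1 2
    simp at this
    rw [m13 1 2 0 2] at this
    linarith
  have a1111 : m 1 1 1 1 = m 0 0 0 0 := by simpa using h90 1 1 1 1
  have a0111 : m 0 1 1 1 = -m 0 0 0 1 := by
    have := h90 0 1 1 1
    simp at this
    rwa [m13 1 0 0 0, m1234 0 0 1 0] at this
  have a0011 := h345 0 0 0 0
  have a0001 := h345 0 0 0 1
  simp at a0011 a0001
  simp only [m13 1 _ 0, m24 _ 1 _ 0, m1234 0 0 1 0, m1234 1 0 1 0, m1234 1 0 1 1, a1111, a0111]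
    at a0011 a0001
  -- The two equations form a nonsingular homogeneous system in `m 0 0 0 1` and `m 0 0 0 0 - m 0 1 0
  -- 1 - 2 * m 0 0 1 1`.
  have z0001 : m 0 0 0 1 = 0 := by linarith
  exact ⟨⟨m13, m24, m1234⟩, z0001, z0002, z0102, z0012, by rw [a0111, z0001, neg_zero], z0112,
    z0212, z0121, z0122, z0222, z1112, z1222, by linarith, a1111, by simpa using h90 1 2 1 2,
    by simpa using h90 1 1 2 2⟩

theorem apply_eq_of_mem_invariants (hM : M ∈ invariants e SO2) (S : W V)
    {s : Fin 3 → Fin 3 → Fin 3 → Fin 3 → ℝ}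
    (h : ∀ i j k l, (S : FourTensor V) (e i ⊗ₜ e j) (e k ⊗ₜ e l) = s i j k l) :
    M S = coeff e M 0 0 0 0 * (s 0 0 0 0 + 2 * s 0 0 1 1 + s 1 1 1 1)
      + coeff e M 0 1 0 1 * (2 * s 0 1 0 1 - 2 * s 0 0 1 1)
      + 2 * coeff e M 0 2 0 2 * (s 0 2 0 2 + s 1 2 1 2)
      + coeff e M 2 2 2 2 * s 2 2 2 2
      + 4 * coeff e M 0 0 2 2 * (s 0 0 2 2 + s 1 1 2 2) := by
  obtain rfl : (fun i j k l => (S : FourTensor V) (e i ⊗ₜ e j) (e k ⊗ₜ e l)) = s := by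
    ext i j k l
    exact h i j k l
  rw [apply_eq_sum_coeff e M S]
  exact (isTransverselyIsotropic_coeff hM).sum_mul (isSymmArray_entries e S)

end Rotations

/-! ### Invariance under reflections -/

section Reflections

variable {V : Type*} [AddCommGroup V] [Module ℝ V] {e : Module.Basis (Fin 3) ℝ V}
  {M : Module.Dual ℝ (W V)}

theorem act_id : act LinearMap.id M = M := by
  refine LinearMap.ext fun S => congrArg M (Subtype.ext <| fourTensor_ext fun _ _ _ _ => rfl)

theorem act_comp (f g : V →ₗ[ℝ] V) : act (f ∘ₗ g) M = act f (act g M) := by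
  refine LinearMap.ext fun S => congrArg M (Subtype.ext <| fourTensor_ext fun _ _ _ _ => rfl)

theorem act_Q_eq (hM : M ∈ invariants e SO2) (n : Fin 3) :
    act (Matrix.toLin e e (Q n : Matrix (Fin 3) (Fin 3) ℝ)) M = M := by
  have hf (j : Fin 3) : Matrix.toLin e e (Q n : Matrix (Fin 3) (Fin 3) ℝ) (e j) =
      (if j = n then -1 else 1 : ℝ) • e j := by
    simp [Matrix.toLin_self, Q, Matrix.diagonal_apply]
  refine LinearMap.ext fun S => ?_
  rw [act, LinearMap.comp_apply, apply_eq_of_mem_invariants hM S fun _ _ _ _ => rfl,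
    apply_eq_of_mem_invariants hM (pullbackW _ S)
      (s := fun i j k l => (if i = n then -1 else 1) * (if j = n then -1 else 1) *
        ((if k = n then -1 else 1) * (if l = n then -1 else 1)) *
          (S : FourTensor V) (e i ⊗ₜ e j) (e k ⊗ₜ e l)) fun i j k l => ?_]
  · fin_cases n <;> simp
  · change (S : FourTensor V) (_ ⊗ₜ _) (_ ⊗ₜ _) = _
    rw [hf, hf, hf, hf]
    simp only [TensorProduct.smul_tmul_smul, map_smul, LinearMap.smul_apply, smul_eq_mul]
    ring

theorem invariants_SO2_le_invariants_Z2cubed : invariants e SO2 ≤ invariants e Z2cubed := by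
  intro M hM A hA
  induction hA using Subgroup.closure_induction with
  | mem A hA =>
    obtain ⟨n, rfl⟩ := hA
    exact act_Q_eq hM n
  | one => rw [OneMemClass.coe_one, Matrix.toLin_one, act_id]
  | mul A B _ _ hA hB =>
    rw [Submonoid.coe_mul, Matrix.toLin_mul e e e, act_comp, hB, hA]
  | inv A _ hA =>
    conv_lhs => rw [← hA]
    rw [← act_comp, ← Matrix.toLin_mul e e e, ← Submonoid.coe_mul, inv_mul_cancel,
      OneMemClass.coe_one, Matrix.toLin_one, act_id]

end Reflections

/-! ### Elastic bounds and the dual cone -/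

section Bounds

/-- A quartic condition on a binary form bounds it on positive semi-definite matrices. -/
theorem add_add_nonneg_of_quartic {a b c x y z : ℝ}
    (h : ∀ p q : ℝ, 0 ≤ a * p ^ 4 + b * (p ^ 2 * q ^ 2) + c * q ^ 4)
    (hx : 0 ≤ x) (hz : 0 ≤ z) (hy : 0 ≤ y) (hxyz : y ^ 2 ≤ x * z) :
    0 ≤ a * x + b * y + c * z := by
  have ha : 0 ≤ a := by simpa using h 1 0
  have hc : 0 ≤ c := by simpa using h 0 1
  rcases le_or_gt 0 b with hb | hb
  · positivity
  have sqrt_sq_sq (t : ℝ) : √(√t) ^ 2 = √t := Real.sq_sqrt (Real.sqrt_nonneg t)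
  have sqrt_four {t : ℝ} (ht : 0 ≤ t) : √(√t) ^ 4 = t := by
    rw [show 4 = 2 * 2 by norm_num, pow_mul, sqrt_sq_sq, Real.sq_sqrt ht]
  -- For `b < 0` the worst case is `y = √(x z)`, which is the quartic at the fourth roots of `x` and
  -- `z`.
  have key := h √(√x) √(√z)
  rw [sqrt_four hx, sqrt_four hz, sqrt_sq_sq, sqrt_sq_sq, ← Real.sqrt_mul hx] at key
  have := mul_le_mul_of_nonpos_left (Real.le_sqrt_of_sq_le hxyz) hb.le
  linarith

variable {V : Type*} [AddCommGroup V] [Module ℝ V] {e : Module.Basis (Fin 3) ℝ V}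
  {M : Module.Dual ℝ (W V)}

theorem sq_isPosSemidef (γ : Module.Dual ℝ (V ⊗[ℝ] V)) :
    LinearMap.BilinForm.IsPosSemidef (sq γ) where
  eq _ _ := mul_comm _ _
  nonneg _ := mul_self_nonneg _

theorem satisfiesElasticBounds_of_mem_dual (hM : M ∈ dualPositivityCone V) :
    SatisfiesElasticBounds M :=
  ⟨fun α _ => hM (x := fourthPower α) (sq_isPosSemidef _), fun α β _ =>
    hM (x := elasticTensor α β) ((sq_isPosSemidef _).add (sq_isPosSemidef _))⟩

theorem linearIndependent_pair_of_apply {α β : Module.Dual ℝ V} (x y : V)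
    (h : α x * β y - α y * β x ≠ 0) : LinearIndependent ℝ ![α, β] := by
  rw [LinearIndependent.pair_iff]
  intro s t hst
  have hx : s * α x + t * β x = 0 := by simpa using LinearMap.congr_fun hst x
  have hy : s * α y + t * β y = 0 := by simpa using LinearMap.congr_fun hst y
  constructor
  · refine (mul_eq_zero.1 ?_).resolve_right h
    linear_combination β y * hx - β x * hy
  · refine (mul_eq_zero.1 ?_).resolve_right h
    linear_combination α x * hy - α y * hx

theorem mem_dual_of_satisfiesElasticBounds (hM : M ∈ invariants e SO2)
    (hb : SatisfiesElasticBounds M) : M ∈ dualPositivityCone V := by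
  obtain ⟨h4, h2⟩ := hb
  have hval := fun S s h => apply_eq_of_mem_invariants hM S (s := s) h
  have hval' := fun S => hval S _ fun _ _ _ _ => rfl
  generalize coeff e M 0 0 0 0 = A, coeff e M 0 1 0 1 = c₁, coeff e M 0 2 0 2 = c₃,
    coeff e M 2 2 2 2 = C, coeff e M 0 0 2 2 = d at hval hval'
  have elastic_apply (α β : Module.Dual ℝ V) := hval (elasticTensor α β)
    (fun i j k l => 1 / 2 * (α (e i) * β (e j) * (α (e k) * β (e l))
      + β (e i) * α (e j) * (β (e k) * α (e l)))) fun i j k l => by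
        simp only [elasticTensor, LinearMap.add_apply, sq_apply, vee_tmul, wedge_tmul]
        ring
  have fourth_apply (α : Module.Dual ℝ V) := hval (fourthPower α)
    (fun i j k l => α (e i) * α (e j) * (α (e k) * α (e l))) fun i j k l => rfl
  have hc₁ : 0 ≤ c₁ := by
    have := h2 (e.coord 0) (e.coord 1) (linearIndependent_pair_of_apply (e 0) (e 1) (by simp))
    rw [elastic_apply] at this
    simpa using this
  have hc₃ : 0 ≤ c₃ := by
    have := h2 (e.coord 0) (e.coord 2) (linearIndependent_pair_of_apply (e 0) (e 2) (by simp))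
    rw [elastic_apply] at this
    simpa using this
  have hplus (p q : ℝ) : 0 ≤ A * p ^ 4 + (2 * c₃ + 4 * d) * (p ^ 2 * q ^ 2) + C * q ^ 4 := by
    by_cases hα : p • e.coord 0 + q • e.coord 2 = 0
    · have hp : p = 0 := by simpa using LinearMap.congr_fun hα (e 0)
      have hq : q = 0 := by simpa using LinearMap.congr_fun hα (e 2)
      simp [hp, hq]
    · have := h4 _ hα
      rw [fourth_apply] at this
      simp at this
      linarith
  have hminus (p q : ℝ) : 0 ≤ A * p ^ 4 + (2 * c₃ - 4 * d) * (p ^ 2 * q ^ 2) + C * q ^ 4 := by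
    -- For `p q = 0` the forms used below are dependent, but the middle term vanishes and `hplus`
    -- applies. Otherwise the opposite signs of `q` turn the `0022` entry into `-p² q²` and keep the
    -- `0202` entry at `p² q²`.
    by_cases hpq : p * q = 0
    · have := hplus p q
      rw [← mul_pow, hpq] at this ⊢
      linarith
    · have := h2 (p • e.coord 0 + q • e.coord 2) (p • e.coord 0 - q • e.coord 2)
        (linearIndependent_pair_of_apply (e 0) (e 2) (by
          simp
          intro h
          exact hpq (by linarith)))
      rw [elastic_apply] at this
      simp at this
      linarith
  intro S hS
  have hnn (X : V ⊗[ℝ] V) : 0 ≤ (S : FourTensor V) X X := hS.nonneg X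
  -- These vectors yield, in turn, `w ≥ 0`, the two halves of `|y| ≤ v` (at `r = ±1`), and a binary
  -- quadratic form with coefficients `x`, `2 y`, `z`.
  have hcross := hnn (e 0 ⊗ₜ e 1 - e 1 ⊗ₜ e 0)
  have h02 (r : ℝ) := hnn (e 0 ⊗ₜ e 2 + r • e 2 ⊗ₜ e 0)
  have h12 (r : ℝ) := hnn (e 1 ⊗ₜ e 2 + r • e 2 ⊗ₜ e 1)
  have htr (r t : ℝ) := hnn (r • (e 0 ⊗ₜ e 0 + e 1 ⊗ₜ e 1) + t • e 2 ⊗ₜ e 2)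
  change 0 ≤ M S
  rw [hval' S]
  have hsym := isSymmArray_entries e S
  simp only [map_add, map_sub, map_smul, LinearMap.add_apply, LinearMap.sub_apply,
    LinearMap.smul_apply, smul_eq_mul] at hcross h02 h12 htr
  generalize hs : (fun i j k l => (S : FourTensor V) (e i ⊗ₜ e j) (e k ⊗ₜ e l)) = s
    at hsym
  obtain ⟨s13, s24, s1234⟩ := hsym
  have hs' (i j k l) : (S : FourTensor V) (e i ⊗ₜ e j) (e k ⊗ₜ e l) = s i j k l := by rw [← hs]
  simp only [hs'] at hcross h02 h12 htr ⊢
  rw [s1234 1 0 1 0, s24 0 1 1 0, s13 1 0 0 1] at hcross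
  simp only [s1234 2 0 2 0, s24 0 2 2 0, s13 2 0 0 2] at h02
  simp only [s1234 2 1 2 1, s24 1 2 2 1, s13 2 1 1 2] at h12
  have s1100 : s 1 1 0 0 = s 0 0 1 1 := by rw [s13, s24]
  have s2200 : s 2 2 0 0 = s 0 0 2 2 := by rw [s13, s24]
  have s2211 : s 2 2 1 1 = s 1 1 2 2 := by rw [s13, s24]
  simp only [s1100, s2200, s2211] at htr
  have hx : 0 ≤ s 0 0 0 0 + 2 * s 0 0 1 1 + s 1 1 1 1 := by linarith [htr 1 0]
  have hz : 0 ≤ s 2 2 2 2 := by linarith [htr 0 1]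
  have hdisc : (s 0 0 2 2 + s 1 1 2 2) ^ 2
      ≤ (s 0 0 0 0 + 2 * s 0 0 1 1 + s 1 1 1 1) * s 2 2 2 2 := by
    have := discrim_le_zero (a := s 0 0 0 0 + 2 * s 0 0 1 1 + s 1 1 1 1)
      (b := 2 * (s 0 0 2 2 + s 1 1 2 2)) (c := s 2 2 2 2) fun r => by linarith [htr r 1]
    rw [discrim] at this
    linarith
  have hw := mul_nonneg hc₁ (show 0 ≤ 2 * s 0 1 0 1 - 2 * s 0 0 1 1 by linarith)
  rcases le_total 0 (s 0 0 2 2 + s 1 1 2 2) with hy | hy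
  · have h1 := add_add_nonneg_of_quartic hplus hx hz hy hdisc
    have h2 := mul_nonneg hc₃ (show 0 ≤ s 0 2 0 2 + s 1 2 1 2 - (s 0 0 2 2 + s 1 1 2 2) by
      linarith [h02 (-1), h12 (-1)])
    linarith
  · have h1 := add_add_nonneg_of_quartic hminus hx hz (neg_nonneg.2 hy) (by rwa [neg_sq])
    have h2 := mul_nonneg hc₃ (show 0 ≤ s 0 2 0 2 + s 1 2 1 2 + (s 0 0 2 2 + s 1 1 2 2) by
      linarith [h02 1, h12 1])
    linarith

end Bounds

end Amplitude

theorem mainTheorem5 {V : Type*} [AddCommGroup V] [Module ℝ V]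
    (e : Module.Basis (Fin 3) ℝ V) :
    Amplitude.invariants e Amplitude.SO2 ≤ Amplitude.invariants e Amplitude.Z2cubed ∧
      ∀ M ∈ Amplitude.invariants e Amplitude.SO2,
        (M ∈ Amplitude.dualPositivityCone V ↔ Amplitude.SatisfiesElasticBounds M) :=
  ⟨Amplitude.invariants_SO2_le_invariants_Z2cubed, fun _ hM =>
    ⟨Amplitude.satisfiesElasticBounds_of_mem_dual,
      Amplitude.mem_dual_of_satisfiesElasticBounds hM⟩⟩
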